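/- Let $n\ge 1$, let $\varphi$ be a norm on $\mathbb{R}^n$ (not necessarily Euclidean, with no smoothness or strict convexity assumed), let $\varphi^*(\xi)=\max\{\xi\cdot\eta:\varphi(\eta)\le 1\}$ be its dual norm, and let $\Omega\subset\mathbb{R}^n$ be a non-empty open set of finite Lebesgue measure. For $v\in BV(\mathbb{R}^n)$ put $$\int_\Omega\varphi^*(Dv):=\sup\Big\{\int_\Omega v\,\mathrm{div}\,\eta\,dx:\ \eta\in C^1_c(\mathbb{R}^n;\mathbb{R}^n),\ \varphi(\eta(x))\le 1\text{ for all }x\Big\}$$ (the test fields have compact support in $\mathbb{R}^n$, not necessarily in $\Omega$). Then for every real $m\ge 0$ the variational problem $$\min\Big\{\int_\Omega\varphi^*(Du):\ u\in BV(\mathbb{R}^n),\ u=0\text{ a.e. on }\mathbb{R}^n\setminus\Omega,\ u(x)\in\mathbb{N}=\{0,1,2,\dots\}\text{ for a.e. }x,\ \int_\Omega u\,dx=m\Big\}$$ has a (possibly non-unique) minimizer: there is an admissible $u$ such that $\int_\Omega\varphi^*(Du)\le\int_\Omega\varphi^*(Dv)$ for every admissible $v$. -/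

import Mathlib

open MeasureTheory

namespace AnisoVar

/-- The Euclidean space `ℝⁿ`. -/
abbrev Rn (n : ℕ) : Type := EuclideanSpace ℝ (Fin n)

/-- The divergence `∑ᵢ ∂ᵢ ηᵢ` of a (differentiable) vector field on `ℝⁿ`. -/
noncomputable def divergence {n : ℕ} (η : Rn n → Rn n) (x : Rn n) : ℝ :=
  ∑ i : Fin n, (fderiv ℝ η x (EuclideanSpace.single i 1)) i

/-- The admissible test fields: `C¹` vector fields with compact support in `ℝⁿ` (not necessarily
in `Ω`) such that `φ (η x) ≤ 1` for every `x`. -/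
def testFields {n : ℕ} (φ : Seminorm ℝ (Rn n)) : Set (Rn n → Rn n) :=
  {η | ContDiff ℝ 1 η ∧ HasCompactSupport η ∧ ∀ x, φ (η x) ≤ 1}

/-- The anisotropic total variation
`∫_Ω φ^*(Dv) = sup {∫_Ω v div η dx : η ∈ C¹_c(ℝⁿ; ℝⁿ), φ(η) ≤ 1}`, with values in `[0, ∞]`.
The set of test fields is symmetric and contains `0`, so that replacing a negative integral by `0`
does not change the supremum. -/
noncomputable def variation {n : ℕ} (φ : Seminorm ℝ (Rn n)) (Ω : Set (Rn n)) (v : Rn n → ℝ) :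
    ENNReal :=
  ⨆ η ∈ testFields φ, ENNReal.ofReal (∫ x in Ω, v x * divergence η x)

/-- `u ∈ BV(ℝⁿ)`: `u` is integrable and its (Euclidean) total variation is finite. -/
def MemBV {n : ℕ} (u : Rn n → ℝ) : Prop :=
  Integrable u ∧ variation (normSeminorm ℝ (Rn n)) Set.univ u < ⊤

/-- The competitors: `u ∈ BV(ℝⁿ)`, `u = 0` a.e. outside `Ω`, `u` has values in `ℕ` a.e., and
`∫_Ω u = m`. -/
def competitors {n : ℕ} (Ω : Set (Rn n)) (m : ℝ) : Set (Rn n → ℝ) :=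
  {u | MemBV u ∧ (∀ᵐ x, x ∉ Ω → u x = 0) ∧ (∀ᵐ x, ∃ k : ℕ, u x = k) ∧ ∫ x in Ω, u x = m}

/-- `u` minimizes `∫_Ω φ^*(Du)` among the competitors. -/
def IsMinimizer {n : ℕ} (φ : Seminorm ℝ (Rn n)) (Ω : Set (Rn n)) (m : ℝ) (u : Rn n → ℝ) : Prop :=
  u ∈ competitors Ω m ∧ ∀ v ∈ competitors Ω m, variation φ Ω u ≤ variation φ Ω v

end AnisoVar

/-!
The proof is the direct method, with strong `L¹` compactness of a minimizing sequence.

The set of competitors is not empty (`competitors_nonempty`): a large integer `N` times the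
indicator of a cube of volume `m / N` inside `Ω` is a competitor, and the divergence theorem on the
cube bounds its total variation by `N` times the area of the faces.

All norms being comparable, the Euclidean variations along a minimizing sequence `uₖ` are bounded by
some `V` (`variation_norm_univ_le`), and `∫ |uₖ| = m`. Compactness is needed on an open set `Ω`
which may be unbounded and irregular, and is obtained without Sobolev or isoperimetric inequalities.
A function of variation at most `V` satisfies `∫ |u(x + h) - u(x)| dx ≤ ‖h‖ V`
(`integral_abs_translate_sub_le`), because moving a test function is a flow whose generator is a
divergence. Hence replacing `u` near each point by its mean over a nearby ball of radius `ε`, with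
centre in a fixed countable set, costs only `O(ε V)` in `L¹`
(`lintegral_enorm_sub_ballMean_le`). For fixed `ε` these means are bounded by `m / |B_ε|`, and they
are indexed by a countable set, so that by Tychonoff's theorem all of them converge along a
subsequence; dominated convergence on `Ω`, which has finite measure, shows that the averaged
functions converge in `L¹(Ω)`. So the subsequence is Cauchy in `L¹`
(`exists_subseq_tendsto_of_variation_le`).

The limit is a competitor, since integrality and vanishing outside `Ω` pass to limits almost
everywhere and the integral passes to limits in `L¹` (`mem_competitors_of_tendsto`), and it is a
minimizer because the variation, a supremum of `L¹`-continuous functionals, is lower semicontinuous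
(`variation_le_of_tendsto`).
-/

namespace AnisoVar

open Filter Topology

variable {n : ℕ}

/-! ### Test fields and their divergence -/

theorem divergence_continuous {η : Rn n → Rn n} (h : ContDiff ℝ 1 η) :
    Continuous (divergence η) := by
  have h' := h.continuous_fderiv one_ne_zero
  unfold divergence
  fun_prop

theorem divergence_hasCompactSupport {η : Rn n → Rn n} (h : HasCompactSupport η) :
    HasCompactSupport (divergence η) := by
  refine (h.fderiv (𝕜 := ℝ)).mono fun x hx => ?_
  contrapose! hx
  simp only [Function.mem_support, not_not] at hx ⊢
  simp [divergence, hx]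

theorem integrable_mul_divergence {η : Rn n → Rn n} (h : ContDiff ℝ 1 η)
    (hc : HasCompactSupport η) {μ : Measure (Rn n)} {u : Rn n → ℝ} (hu : Integrable u μ) :
    Integrable (fun x => u x * divergence η x) μ := by
  obtain ⟨C, hC⟩ :=
    (divergence_hasCompactSupport hc).exists_bound_of_continuous (divergence_continuous h)
  exact hu.mul_bdd (c := C) (divergence_continuous h).aestronglyMeasurable (ae_of_all _ hC)

theorem integral_mul_divergence_le {φ : Seminorm ℝ (Rn n)} {Ω : Set (Rn n)} {u : Rn n → ℝ}
    {V : ℝ} (hV : 0 ≤ V) (hu : variation φ Ω u ≤ ENNReal.ofReal V) {η : Rn n → Rn n}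
    (hη : η ∈ testFields φ) : ∫ x in Ω, u x * divergence η x ≤ V := by
  rw [← ENNReal.ofReal_le_ofReal_iff hV]
  exact (le_iSup₂ (f := fun η (_ : η ∈ testFields φ) =>
    ENNReal.ofReal (∫ x in Ω, u x * divergence η x)) η hη).trans hu

/-! ### Translations of functions of bounded variation -/

/-- Integrating against a directional derivative is controlled by the variation: this is the test
field `ψ h / ‖h‖`. -/
theorem integral_mul_fderiv_le {u : Rn n → ℝ} {V : ℝ} (hV : 0 ≤ V)
    (hu : variation (normSeminorm ℝ (Rn n)) Set.univ u ≤ ENNReal.ofReal V)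
    {ψ : Rn n → ℝ} (hψ : ContDiff ℝ 1 ψ) (hc : HasCompactSupport ψ) (h1 : ∀ x, |ψ x| ≤ 1)
    (h : Rn n) : ∫ x, u x * fderiv ℝ ψ x h ≤ ‖h‖ * V := by
  rcases eq_or_ne h 0 with rfl | hh
  · simp
  have hpos : 0 < ‖h‖ := norm_pos_iff.2 hh
  set e : Rn n := ‖h‖⁻¹ • h with he
  have hen : ‖e‖ = 1 := by rw [he, norm_smul, norm_inv, norm_norm, inv_mul_cancel₀ hpos.ne']
  have hη : (fun x => ψ x • e) ∈ testFields (normSeminorm ℝ (Rn n)) := by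
    refine ⟨hψ.smul contDiff_const, hc.smul_right, fun x => ?_⟩
    simpa [norm_smul, hen] using h1 x
  have hdiv : ∀ x, divergence (fun x => ψ x • e) x = fderiv ℝ ψ x e := by
    intro x
    have hd : HasFDerivAt (fun x => ψ x • e) ((fderiv ℝ ψ x).smulRight e) x :=
      ((hψ.differentiable one_ne_zero x).hasFDerivAt).smul_const e
    have hs : e = ∑ i, e i • EuclideanSpace.single i (1 : ℝ) := by
      simpa using ((EuclideanSpace.basisFun (Fin n) ℝ).sum_repr e).symm
    conv_rhs => rw [hs]
    simp [divergence, hd.fderiv, mul_comm]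
  have key := integral_mul_divergence_le hV hu hη
  simp only [hdiv, Measure.restrict_univ] at key
  have : ∀ x, u x * fderiv ℝ ψ x h = ‖h‖ * (u x * fderiv ℝ ψ x e) := by
    intro x
    rw [he, map_smul, smul_eq_mul]
    field_simp
  simp only [this, integral_const_mul]
  gcongr

/-- Moving a test function by `h` changes its pairing with `u` by at most `‖h‖ V`: the pairing with
the function moved by `t h` has derivative at most `‖h‖ V`. -/
theorem integral_mul_sub_translate_le {u : Rn n → ℝ} (hui : Integrable u) {V : ℝ} (hV : 0 ≤ V)
    (hu : variation (normSeminorm ℝ (Rn n)) Set.univ u ≤ ENNReal.ofReal V)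
    {ψ : Rn n → ℝ} (hψ : ContDiff ℝ 1 ψ) (hc : HasCompactSupport ψ) (h1 : ∀ x, |ψ x| ≤ 1)
    (h : Rn n) : (∫ x, u x * ψ (x - h)) - ∫ x, u x * ψ x ≤ ‖h‖ * V := by
  have hψt : ∀ t : ℝ, ContDiff ℝ 1 (fun x => ψ (x - t • h)) := fun t =>
    hψ.comp (contDiff_id.sub contDiff_const)
  have hct : ∀ t : ℝ, HasCompactSupport (fun x => ψ (x - t • h)) := fun t => by
    simpa [sub_eq_add_neg, Function.comp_def] using
      hc.comp_homeomorph (Homeomorph.addRight (-(t • h)))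
  have hft : ∀ (t : ℝ) x, fderiv ℝ (fun x => ψ (x - t • h)) x = fderiv ℝ ψ (x - t • h) :=
    fun t x => by simp [fderiv_comp_sub]
  have hcf : Continuous (fderiv ℝ ψ) := hψ.continuous_fderiv one_ne_zero
  obtain ⟨C, hC⟩ := (hc.fderiv (𝕜 := ℝ)).exists_bound_of_continuous hcf
  have hder : ∀ t : ℝ, HasDerivAt (fun t : ℝ => ∫ x, u x * ψ (x - t • h))
      (∫ x, u x * -(fderiv ℝ ψ (x - t • h) h)) t := by
    intro t
    have hcont : ∀ s : ℝ, Continuous fun x => ψ (x - s • h) := fun s => (hψt s).continuous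
    refine (hasDerivAt_integral_of_dominated_loc_of_deriv_le
      (F := fun (t : ℝ) x => u x * ψ (x - t • h))
      (F' := fun (t : ℝ) x => u x * -(fderiv ℝ ψ (x - t • h) h))
      (bound := fun x => ‖u x‖ * (C * ‖h‖)) (s := Set.univ) Filter.univ_mem ?_ ?_ ?_ ?_ ?_ ?_).2
    · exact Filter.Eventually.of_forall fun s =>
        hui.aestronglyMeasurable.mul (hcont s).aestronglyMeasurable
    · exact hui.mul_bdd (c := 1) (hcont t).aestronglyMeasurable (ae_of_all _ fun x => h1 _)
    · refine hui.aestronglyMeasurable.mul (Continuous.aestronglyMeasurable ?_)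
      fun_prop
    · refine ae_of_all _ fun x s _ => ?_
      rw [norm_mul, norm_neg]
      gcongr
      exact (ContinuousLinearMap.le_opNorm _ _).trans (by gcongr; exact hC _)
    · exact hui.norm.mul_const _
    · refine ae_of_all _ fun x s _ => ?_
      have h2 : HasDerivAt (fun s : ℝ => x - s • h) (-h) s := by
        simpa using ((hasDerivAt_id s).smul_const h).const_sub x
      have h3 := ((hψ.differentiable one_ne_zero (x - s • h)).hasFDerivAt).comp_hasDerivAt s h2
      simpa using h3.const_mul (u x)
  have hbd : ∀ t : ℝ, ∫ x, u x * -(fderiv ℝ ψ (x - t • h) h) ≤ ‖h‖ * V := by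
    intro t
    have := integral_mul_fderiv_le hV hu (hψt t) (hct t) (fun x => h1 _) (-h)
    simpa [hft] using this
  have := image_sub_le_mul_sub_of_deriv_le (f := fun t : ℝ => ∫ x, u x * ψ (x - t • h))
    (fun t => (hder t).differentiableAt) (C := ‖h‖ * V)
    (fun t => by rw [(hder t).deriv]; exact hbd t) (zero_le_one)
  simpa only [zero_smul, one_smul, sub_zero, mul_one] using this

/-- The `L¹` norm is recovered by pairing with `C¹` functions of compact support that are bounded
by `1`; such functions approximating the sign are `g / √(g² + δ²)` with `g` smooth and close
to `w`. -/
theorem integral_abs_le_of_forall_contDiff {w : Rn n → ℝ} (hw : Integrable w) {M : ℝ}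
    (H : ∀ ψ : Rn n → ℝ, ContDiff ℝ 1 ψ → HasCompactSupport ψ → (∀ x, |ψ x| ≤ 1) →
      ∫ x, w x * ψ x ≤ M) : ∫ x, |w x| ≤ M := by
  refine le_of_forall_pos_le_add fun ε hε => ?_
  obtain ⟨g, hgc, hg, hwg⟩ := (memLp_one_iff_integrable.2 hw).exist_eLpNorm_sub_le
    (by simp) le_rfl (show 0 < ε / 3 by positivity)
  have hgi : Integrable g := hg.continuous.integrable_of_hasCompactSupport hgc
  have hdist : ∫ x, |w x - g x| ≤ ε / 3 := by
    rw [eLpNorm_one_eq_lintegral_enorm, ← ofReal_integral_norm_eq_lintegral_enorm (hw.sub hgi),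
      ENNReal.ofReal_le_ofReal_iff (by positivity)] at hwg
    simpa using hwg
  set K := tsupport g
  have hK : volume K < ⊤ := hgc.isCompact.measure_lt_top
  set δ : ℝ := ε / 3 / (volume.real K + 1) with hδ
  have hδ0 : 0 < δ := by positivity
  have hδK : δ * volume.real K ≤ ε / 3 := by
    rw [hδ, div_mul_eq_mul_div, div_le_iff₀ (by positivity)]
    nlinarith [measureReal_nonneg (μ := volume) (s := K)]
  set ψ : Rn n → ℝ := fun x => g x / √(g x ^ 2 + δ ^ 2) with hψdef
  have hpos : ∀ x, 0 < g x ^ 2 + δ ^ 2 := fun x => by positivity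
  have hψ : ContDiff ℝ 1 ψ := by
    have hg1 : ContDiff ℝ 1 g := hg.of_le (by exact_mod_cast le_top)
    exact hg1.div (((hg1.pow 2).add contDiff_const).sqrt fun x => (hpos x).ne')
      fun x => (Real.sqrt_pos.2 (hpos x)).ne'
  have hψc : HasCompactSupport ψ := by
    refine hgc.mono fun x hx => ?_
    contrapose! hx
    simp only [Function.mem_support, not_not] at hx ⊢
    simp [hψdef, hx]
  have hψ1 : ∀ x, |ψ x| ≤ 1 := by
    intro x
    rw [hψdef]
    simp only [abs_div, abs_of_nonneg (Real.sqrt_nonneg _)]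
    refine div_le_one_of_le₀ (Real.le_sqrt_of_sq_le ?_) (Real.sqrt_nonneg _)
    rw [sq_abs]; nlinarith [sq_nonneg δ]
  have hlow : ∀ x, |g x| ≤ g x * ψ x + K.indicator (fun _ => δ) x := by
    intro x
    by_cases hx : x ∈ K
    · rw [Set.indicator_of_mem hx]
      have hs := Real.sqrt_pos.2 (hpos x)
      have h1 : |g x| ≤ √(g x ^ 2 + δ ^ 2) := Real.abs_le_sqrt (by nlinarith [sq_nonneg δ])
      have h2 : δ ≤ √(g x ^ 2 + δ ^ 2) := Real.le_sqrt_of_sq_le (by nlinarith [sq_nonneg (g x)])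
      have h3 := Real.sq_sqrt (hpos x).le
      have h4 : g x * ψ x = g x ^ 2 / √(g x ^ 2 + δ ^ 2) := by simp only [hψdef]; ring
      rw [h4, ← sub_le_iff_le_add, le_div_iff₀ hs]
      nlinarith
    · have : g x = 0 := image_eq_zero_of_notMem_tsupport hx
      simp [this, hx]
  have hKm : MeasurableSet K := (isClosed_tsupport g).measurableSet
  have hwψ : Integrable fun x => w x * ψ x :=
    hw.mul_bdd (c := 1) hψ.continuous.aestronglyMeasurable (ae_of_all _ hψ1)
  have hind : Integrable (K.indicator fun _ => δ) :=
    (integrable_indicator_iff hKm).2 (integrableOn_const hK.ne)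
  have hd : Integrable fun x => |w x - g x| := (hw.sub hgi).abs
  have hpt : ∀ x, |w x| ≤ w x * ψ x + 2 * |w x - g x| + K.indicator (fun _ => δ) x := by
    intro x
    have h1 := hlow x
    have h2 : |w x| ≤ |w x - g x| + |g x| := by simpa using abs_add_le (w x - g x) (g x)
    have h3 : |(w x - g x) * ψ x| ≤ |w x - g x| := by
      rw [abs_mul]; exact mul_le_of_le_one_right (abs_nonneg _) (hψ1 x)
    have h4 := neg_abs_le ((w x - g x) * ψ x)
    linarith [sub_mul (w x) (g x) (ψ x)]
  calc ∫ x, |w x| ≤ ∫ x, (w x * ψ x + 2 * |w x - g x| + K.indicator (fun _ => δ) x) :=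
        integral_mono hw.abs ((hwψ.add (hd.const_mul 2)).add hind) hpt
    _ = (∫ x, w x * ψ x) + 2 * (∫ x, |w x - g x|) + δ * volume.real K := by
        rw [integral_add (by exact hwψ.add (hd.const_mul 2)) hind, integral_add hwψ (hd.const_mul 2),
          integral_const_mul, integral_indicator hKm, setIntegral_const, smul_eq_mul, mul_comm δ]
    _ ≤ M + ε := by linarith [H ψ hψ hψc hψ1]

/-- A function of bounded variation moves in `L¹` at most at the speed of its variation. -/
theorem integral_abs_translate_sub_le {u : Rn n → ℝ} (hui : Integrable u) {V : ℝ} (hV : 0 ≤ V)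
    (hu : variation (normSeminorm ℝ (Rn n)) Set.univ u ≤ ENNReal.ofReal V) (h : Rn n) :
    ∫ x, |u (x + h) - u x| ≤ ‖h‖ * V := by
  have huh : Integrable fun x => u (x + h) := hui.comp_add_right h
  refine integral_abs_le_of_forall_contDiff (huh.sub hui) fun ψ hψ hc h1 => ?_
  have hb : ∀ {v : Rn n → ℝ}, Integrable v → Integrable fun x => v x * ψ x := fun hv =>
    hv.mul_bdd (c := 1) hψ.continuous.aestronglyMeasurable (ae_of_all _ h1)
  have h2 : ∫ x, u (x + h) * ψ x = ∫ x, u x * ψ (x - h) := by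
    simpa using integral_add_right_eq_self (μ := volume) (fun x => u x * ψ (x - h)) h
  simp only [Pi.sub_apply, sub_mul]
  rw [integral_sub (hb huh) (hb hui), h2]
  exact integral_mul_sub_translate_le hui hV hu hψ hc h1 h

theorem lintegral_enorm_translate_sub_le {u : Rn n → ℝ} (hui : Integrable u) {V : ℝ} (hV : 0 ≤ V)
    (hu : variation (normSeminorm ℝ (Rn n)) Set.univ u ≤ ENNReal.ofReal V) (h : Rn n) :
    ∫⁻ x, ‖u (x + h) - u x‖ₑ ≤ ENNReal.ofReal (‖h‖ * V) := by
  have := ofReal_integral_norm_eq_lintegral_enorm ((hui.comp_add_right h).sub hui)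
  simp only [Pi.sub_apply] at this
  rw [← this]
  exact ENNReal.ofReal_le_ofReal (integral_abs_translate_sub_le hui hV hu h)

/-! ### Ball means and the Poincaré inequality -/

/-- The index of the first point of a fixed dense sequence at distance less than `ε` from `x`. -/
noncomputable def nearIndex (ε : ℝ) (x : Rn n) : ℕ :=
  sInf {i | dist x (TopologicalSpace.denseSeq (Rn n) i) < ε}

theorem dist_denseSeq_nearIndex_lt {ε : ℝ} (hε : 0 < ε) (x : Rn n) :
    dist x (TopologicalSpace.denseSeq (Rn n) (nearIndex ε x)) < ε :=
  Nat.sInf_mem (s := {i | dist x (TopologicalSpace.denseSeq (Rn n) i) < ε})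
    ((TopologicalSpace.denseRange_denseSeq (Rn n)).exists_dist_lt x hε)

theorem measurable_nearIndex {ε : ℝ} (hε : 0 < ε) : Measurable (nearIndex (n := n) ε) := by
  classical
  have hex : ∀ x : Rn n, ∃ i, dist x (TopologicalSpace.denseSeq (Rn n) i) < ε := fun x =>
    (TopologicalSpace.denseRange_denseSeq (Rn n)).exists_dist_lt x hε
  have : nearIndex (n := n) ε = fun x => Nat.find (hex x) := by
    funext x
    exact Nat.sInf_def (hex x)
  rw [this]
  exact measurable_find hex fun i => measurableSet_lt (by fun_prop) measurable_const

/-- The mean of `u` over the ball of radius `ε` around the `i`-th point of the dense sequence. -/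
noncomputable def ballMean (ε : ℝ) (u : Rn n → ℝ) (i : ℕ) : ℝ :=
  ⨍ y in Metric.ball (TopologicalSpace.denseSeq (Rn n) i) ε, u y

theorem volume_real_ball_pos {ε : ℝ} (hε : 0 < ε) (x : Rn n) :
    0 < volume.real (Metric.ball x ε) :=
  ENNReal.toReal_pos (Metric.measure_ball_pos _ _ hε).ne' measure_ball_lt_top.ne

theorem abs_ballMean_le {ε : ℝ} {u : Rn n → ℝ} (hu : Integrable u) {M : ℝ}
    (hM : ∫ x, |u x| ≤ M) (i : ℕ) :
    |ballMean ε u i| ≤ (volume.real (Metric.ball (0 : Rn n) ε))⁻¹ * M := by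
  rw [ballMean, setAverage_eq, smul_eq_mul, abs_mul, abs_of_nonneg (by positivity),
    measureReal_def, Measure.addHaar_ball_center, ← measureReal_def]
  gcongr
  exact abs_integral_le_integral_abs.trans
    ((setIntegral_le_integral hu.abs (ae_of_all _ fun x => abs_nonneg _)).trans hM)

/-- The oscillation of `u` around a nearby ball mean is controlled by increments of `u` of length
less than `2ε`. -/
theorem enorm_sub_ballMean_le {ε : ℝ} (hε : 0 < ε) {u : Rn n → ℝ} (hu : Integrable u) (x : Rn n) :
    ‖u x - ballMean ε u (nearIndex ε x)‖ₑ ≤ (volume (Metric.ball (0 : Rn n) ε))⁻¹ *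
      ∫⁻ h in Metric.ball (0 : Rn n) (2 * ε), ‖u (x + h) - u x‖ₑ := by
  set c := TopologicalSpace.denseSeq (Rn n) (nearIndex ε x)
  set B := Metric.ball c ε
  have hxc : dist x c < ε := dist_denseSeq_nearIndex_lt hε x
  have hBpos : 0 < volume.real B := volume_real_ball_pos hε c
  have hvB : volume B = volume (Metric.ball (0 : Rn n) ε) := Measure.addHaar_ball_center _ _ _
  have hc : IntegrableOn (fun _ => u x) B := integrableOn_const measure_ball_lt_top.ne
  have h1 : u x - ballMean ε u (nearIndex ε x)
      = -((volume.real B)⁻¹ * ∫ y in B, (u y - u x)) := by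
    rw [show ballMean ε u (nearIndex ε x) = ⨍ y in B, u y from rfl, setAverage_eq,
      integral_sub hu.integrableOn hc, setIntegral_const, smul_eq_mul,
      smul_eq_mul]
    field_simp
    ring
  have h2 : ‖(volume.real B)⁻¹‖ₑ = (volume (Metric.ball (0 : Rn n) ε))⁻¹ := by
    rw [Real.enorm_of_nonneg (by positivity), ENNReal.ofReal_inv_of_pos hBpos, measureReal_def,
      ENNReal.ofReal_toReal measure_ball_lt_top.ne, hvB]
  rw [h1, enorm_neg, enorm_mul, h2]
  gcongr
  refine (enorm_integral_le_lintegral_enorm _).trans ?_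
  have h3 : ∫⁻ h in Metric.ball (0 : Rn n) (2 * ε), ‖u (x + h) - u x‖ₑ
      = ∫⁻ y in Metric.ball x (2 * ε), ‖u y - u x‖ₑ := by
    rw [← lintegral_indicator measurableSet_ball, ← lintegral_indicator measurableSet_ball,
      ← lintegral_add_left_eq_self ((Metric.ball x (2 * ε)).indicator _) x]
    congr 1
    funext h
    simp [Set.indicator, Metric.mem_ball, dist_eq_norm]
  rw [h3]
  refine lintegral_mono_set (Metric.ball_subset_ball' ?_)
  rw [dist_comm]
  linarith

/-- A Poincaré inequality: passing to ball means at scale `ε` costs at most `2ⁿ · 2εV` in `L¹`. -/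
theorem lintegral_enorm_sub_ballMean_le {ε : ℝ} (hε : 0 < ε) {u : Rn n → ℝ} (hui : Integrable u)
    {V : ℝ} (hV : 0 ≤ V)
    (hu : variation (normSeminorm ℝ (Rn n)) Set.univ u ≤ ENNReal.ofReal V) :
    ∫⁻ x, ‖u x - ballMean ε u (nearIndex ε x)‖ₑ ≤ 2 ^ n * ENNReal.ofReal (2 * ε * V) := by
  set v := volume (Metric.ball (0 : Rn n) ε)
  have hv0 : v ≠ 0 := (Metric.measure_ball_pos _ _ hε).ne'
  have hvt : v ≠ ⊤ := measure_ball_lt_top.ne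
  have hvol : volume (Metric.ball (0 : Rn n) (2 * ε)) = 2 ^ n * v := by
    rw [Measure.addHaar_ball_mul_of_pos _ _ two_pos, finrank_euclideanSpace_fin,
      ENNReal.ofReal_pow two_pos.le, ENNReal.ofReal_ofNat]
  have hmeas : AEMeasurable (fun z : Rn n × Rn n => ‖u (z.1 + z.2) - u z.1‖ₑ)
      (volume.prod (volume.restrict (Metric.ball 0 (2 * ε)))) := by
    have h1 : AEStronglyMeasurable (fun z : Rn n × Rn n => u (z.1 + z.2)) (volume.prod volume) :=
      (hui.aestronglyMeasurable.comp_snd (μ := volume)).comp_measurePreserving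
        (measurePreserving_prod_add volume volume)
    have h2 : AEStronglyMeasurable (fun z : Rn n × Rn n => u z.1) (volume.prod volume) :=
      hui.aestronglyMeasurable.comp_fst
    refine (h1.sub h2).enorm.mono_measure ?_
    exact Measure.prod_mono le_rfl Measure.restrict_le_self
  calc ∫⁻ x, ‖u x - ballMean ε u (nearIndex ε x)‖ₑ
      ≤ ∫⁻ x, v⁻¹ * ∫⁻ h in Metric.ball (0 : Rn n) (2 * ε), ‖u (x + h) - u x‖ₑ :=
        lintegral_mono fun x => enorm_sub_ballMean_le hε hui x
    _ = v⁻¹ * ∫⁻ h in Metric.ball (0 : Rn n) (2 * ε), ∫⁻ x, ‖u (x + h) - u x‖ₑ := by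
        rw [lintegral_const_mul' _ _ (ENNReal.inv_ne_top.2 hv0), lintegral_lintegral_swap hmeas]
    _ ≤ v⁻¹ * ∫⁻ h in Metric.ball (0 : Rn n) (2 * ε), ENNReal.ofReal (2 * ε * V) := by
        gcongr v⁻¹ * ?_
        refine setLIntegral_mono measurable_const fun h hh => ?_
        refine (lintegral_enorm_translate_sub_le hui hV hu h).trans ?_
        have : ‖h‖ ≤ 2 * ε := (mem_ball_zero_iff.1 hh).le
        gcongr
    _ = 2 ^ n * ENNReal.ofReal (2 * ε * V) := by
        rw [setLIntegral_const, hvol, mul_comm (ENNReal.ofReal _), ← mul_assoc, mul_left_comm,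
          ENNReal.inv_mul_cancel hv0 hvt, mul_one]

/-! ### Compactness in `L¹` -/

/-- Along a subsequence, the ball means at countably many scales and centres converge; on a set of
finite measure the averaged functions then converge in `L¹`, and by the Poincaré inequality the
functions themselves come arbitrarily close in `L¹(Ω)` to a fixed function. No mass is lost at
infinity because `Ω` has finite measure and the averaged functions are uniformly bounded. -/
theorem exists_subseq_forall_close {Ω : Set (Rn n)}
    (hfin : volume Ω < ⊤) {u : ℕ → Rn n → ℝ} (hui : ∀ k, Integrable (u k))
    {M V : ℝ} (hM : ∀ k, ∫ x, |u k x| ≤ M) (hV : 0 ≤ V)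
    (hu : ∀ k, variation (normSeminorm ℝ (Rn n)) Set.univ (u k) ≤ ENNReal.ofReal V) :
    ∃ σ : ℕ → ℕ, StrictMono σ ∧ ∀ δ : ENNReal, 0 < δ → ∃ G : Rn n → ℝ,
      AEStronglyMeasurable G (volume.restrict Ω) ∧
      ∀ᶠ k in atTop, ∫⁻ x in Ω, ‖u (σ k) x - G x‖ₑ < δ := by
  obtain ⟨e, he0, he⟩ : ∃ e : ℕ → ℝ, (∀ j, 0 < e j) ∧ Tendsto e atTop (𝓝 0) :=
    ⟨_, fun j => Nat.one_div_pos_of_nat, tendsto_one_div_add_atTop_nhds_zero_nat⟩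
  obtain ⟨R, hR⟩ : ∃ R : ℕ → ℝ, ∀ k j i, |ballMean (e j) (u k) i| ≤ R j :=
    ⟨_, fun k j i => abs_ballMean_le (hui k) (hM k) i⟩
  have hK : IsCompact (Set.univ.pi fun p : ℕ × ℕ => Set.Icc (-R p.1) (R p.1)) :=
    isCompact_univ_pi fun p => isCompact_Icc
  have hmem : ∀ k, (fun p : ℕ × ℕ => ballMean (e p.1) (u k) p.2) ∈
      Set.univ.pi fun p : ℕ × ℕ => Set.Icc (-R p.1) (R p.1) :=
    fun k p _ => abs_le.1 (hR k p.1 p.2)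
  obtain ⟨a, -, σ, hσ, ha⟩ := hK.tendsto_subseq hmem
  rw [tendsto_pi_nhds] at ha
  have hmean : ∀ j, Tendsto (fun k => ∫⁻ x in Ω,
      ‖ballMean (e j) (u (σ k)) (nearIndex (e j) x) - a (j, nearIndex (e j) x)‖ₑ) atTop (𝓝 0) := by
    intro j
    have hm : ∀ f : ℕ → ℝ, AEStronglyMeasurable (fun x : Rn n => f (nearIndex (e j) x))
        (volume.restrict Ω) := fun f =>
      ((measurable_from_nat (f := f)).comp (measurable_nearIndex (he0 j))).aestronglyMeasurable
    have := tendsto_lintegral_norm_of_dominated_convergence (μ := volume.restrict Ω)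
      (F := fun k x => ballMean (e j) (u (σ k)) (nearIndex (e j) x))
      (f := fun x => a (j, nearIndex (e j) x)) (bound := fun _ => R j)
      (fun k => hm (ballMean (e j) (u (σ k))))
      (by have : IsFiniteMeasure (volume.restrict Ω) := ⟨by simpa using hfin⟩
          exact (integrable_const (R j)).2)
      (fun k => ae_of_all _ fun x => hR _ _ _)
      (ae_of_all _ fun x => ha (j, nearIndex (e j) x))
    simpa only [ofReal_norm] using this
  refine ⟨σ, hσ, fun δ hδ => ?_⟩
  have hA : Tendsto (fun j => 2 ^ n * ENNReal.ofReal (2 * e j * V)) atTop (𝓝 0) := by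
    have h1 : Tendsto (fun j => 2 * e j * V) atTop (𝓝 0) := by
      simpa using (he.const_mul 2).mul_const V
    simpa using ENNReal.Tendsto.const_mul (a := 2 ^ n) (ENNReal.tendsto_ofReal h1)
      (Or.inr (by finiteness))
  obtain ⟨j, hj⟩ := (hA.eventually_lt_const (ENNReal.half_pos hδ.ne')).exists
  have hGm : Measurable fun x : Rn n => a (j, nearIndex (e j) x) :=
    (measurable_from_nat (f := fun i => a (j, i))).comp (measurable_nearIndex (he0 j))
  refine ⟨fun x => a (j, nearIndex (e j) x), hGm.aestronglyMeasurable, ?_⟩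
  filter_upwards [(hmean j).eventually_lt_const (ENNReal.half_pos hδ.ne')] with k hk
  have hPm : Measurable fun x : Rn n => ballMean (e j) (u (σ k)) (nearIndex (e j) x) :=
    (measurable_from_nat (f := ballMean (e j) (u (σ k)))).comp (measurable_nearIndex (he0 j))
  calc ∫⁻ x in Ω, ‖u (σ k) x - a (j, nearIndex (e j) x)‖ₑ
      ≤ ∫⁻ x in Ω, (‖u (σ k) x - ballMean (e j) (u (σ k)) (nearIndex (e j) x)‖ₑ +
        ‖ballMean (e j) (u (σ k)) (nearIndex (e j) x) - a (j, nearIndex (e j) x)‖ₑ) := by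
        refine lintegral_mono fun x => ?_
        simpa using enorm_add_le (u (σ k) x - ballMean (e j) (u (σ k)) (nearIndex (e j) x))
          (ballMean (e j) (u (σ k)) (nearIndex (e j) x) - a (j, nearIndex (e j) x))
    _ = _ := lintegral_add_right _ (hPm.sub hGm).enorm
    _ < δ / 2 + δ / 2 := by
        refine ENNReal.add_lt_add (lt_of_le_of_lt ?_ hj) hk
        exact (setLIntegral_le_lintegral _ _).trans
          (lintegral_enorm_sub_ballMean_le (he0 j) (hui _) hV (hu _))
    _ = δ := ENNReal.add_halves δ

/-- Compactness of sets of functions of bounded variation that vanish outside a set of finite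
measure. -/
theorem exists_subseq_tendsto_of_variation_le {Ω : Set (Rn n)} (hΩ : MeasurableSet Ω)
    (hfin : volume Ω < ⊤) {u : ℕ → Rn n → ℝ} (hui : ∀ k, Integrable (u k))
    (hu0 : ∀ k, ∀ᵐ x, x ∉ Ω → u k x = 0) {M V : ℝ} (hM : ∀ k, ∫ x, |u k x| ≤ M) (hV : 0 ≤ V)
    (hu : ∀ k, variation (normSeminorm ℝ (Rn n)) Set.univ (u k) ≤ ENNReal.ofReal V) :
    ∃ σ : ℕ → ℕ, StrictMono σ ∧ ∃ g : Rn n → ℝ, Integrable g ∧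
      (∀ᵐ x, Tendsto (fun k => u (σ k) x) atTop (𝓝 (g x))) ∧
      Tendsto (fun k => ∫⁻ x, ‖u (σ k) x - g x‖ₑ) atTop (𝓝 0) := by
  obtain ⟨σ, hσ, hclose⟩ := exists_subseq_forall_close hfin hui hM hV hu
  set F : ℕ → Lp ℝ 1 (volume : Measure (Rn n)) := fun k => (hui (σ k)).toL1 _
  have hedist : ∀ k l, edist (F k) (F l) = ∫⁻ x in Ω, ‖u (σ k) x - u (σ l) x‖ₑ := by
    intro k l
    rw [Integrable.edist_toL1_toL1, ← lintegral_indicator hΩ]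
    refine lintegral_congr_ae ?_
    filter_upwards [hu0 (σ k), hu0 (σ l)] with x hk hl
    by_cases hx : x ∈ Ω
    · simp [hx, edist_eq_enorm_sub]
    · simp [hx, hk hx, hl hx]
  have hcauchy : CauchySeq F := by
    rw [EMetric.cauchySeq_iff]
    intro δ hδ
    obtain ⟨G, hGm, hG⟩ := hclose (δ / 2) (ENNReal.half_pos hδ.ne')
    obtain ⟨N, hN⟩ := eventually_atTop.1 hG
    refine ⟨N, fun k hk l hl => ?_⟩
    rw [hedist]
    calc ∫⁻ x in Ω, ‖u (σ k) x - u (σ l) x‖ₑ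
        ≤ ∫⁻ x in Ω, (‖u (σ k) x - G x‖ₑ + ‖u (σ l) x - G x‖ₑ) := by
          refine lintegral_mono fun x => ?_
          simpa using enorm_sub_le (a := u (σ k) x - G x) (b := u (σ l) x - G x)
      _ = _ := lintegral_add_right' _ ((hui (σ l)).aestronglyMeasurable.restrict.sub hGm).enorm
      _ < δ / 2 + δ / 2 := ENNReal.add_lt_add (hN k hk) (hN l hl)
      _ = δ := ENNReal.add_halves δ
  obtain ⟨g, hg⟩ := cauchySeq_tendsto_of_complete hcauchy
  have hL : Tendsto (fun k => eLpNorm (u (σ k) - ⇑g) 1 volume) atTop (𝓝 0) := by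
    refine ((Lp.tendsto_Lp_iff_tendsto_eLpNorm' F g).1 hg).congr fun k => ?_
    exact eLpNorm_congr_ae ((hui (σ k)).coeFn_toL1.sub (ae_eq_refl _))
  obtain ⟨τ, hτ, hae⟩ := (tendstoInMeasure_of_tendsto_eLpNorm one_ne_zero
    (fun k => (hui (σ k)).aestronglyMeasurable) (Lp.aestronglyMeasurable g) hL).exists_seq_tendsto_ae
  refine ⟨σ ∘ τ, hσ.comp hτ, g, L1.integrable_coeFn g, hae, ?_⟩
  simp only [eLpNorm_one_eq_lintegral_enorm, Pi.sub_apply] at hL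
  exact hL.comp hτ.tendsto_atTop

/-! ### Lower semicontinuity and comparison of variations -/

theorem tendsto_integral_mul_of_tendsto_lintegral {u : ℕ → Rn n → ℝ} {g : Rn n → ℝ}
    (hui : ∀ k, Integrable (u k)) (hg : Integrable g)
    (hL : Tendsto (fun k => ∫⁻ x, ‖u k x - g x‖ₑ) atTop (𝓝 0)) (Ω : Set (Rn n)) {f : Rn n → ℝ}
    (hf : Continuous f) {C : ℝ} (hC : ∀ x, ‖f x‖ ≤ C) :
    Tendsto (fun k => ∫ x in Ω, u k x * f x) atTop (𝓝 (∫ x in Ω, g x * f x)) := by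
  have hi : ∀ {v : Rn n → ℝ}, Integrable v →
      Integrable (fun x => v x * f x) (volume.restrict Ω) := fun hv =>
    hv.restrict.mul_bdd (c := C) hf.aestronglyMeasurable (ae_of_all _ hC)
  refine tendsto_integral_of_L1 _ (hi hg).aestronglyMeasurable
    (Eventually.of_forall fun k => hi (hui k)) ?_
  have h0 : Tendsto (fun k => (∫⁻ x, ‖u k x - g x‖ₑ) * ENNReal.ofReal C) atTop (𝓝 0) := by
    simpa using ENNReal.Tendsto.mul_const hL (Or.inr ENNReal.ofReal_ne_top)
  refine tendsto_of_tendsto_of_tendsto_of_le_of_le tendsto_const_nhds h0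
    (fun k => zero_le) fun k => ?_
  refine (setLIntegral_le_lintegral _ _).trans ?_
  rw [← lintegral_mul_const' _ _ ENNReal.ofReal_ne_top]
  refine lintegral_mono fun x => ?_
  rw [← sub_mul, enorm_mul]
  gcongr
  rw [← ofReal_norm]
  exact ENNReal.ofReal_le_ofReal (hC x)

/-- The variation is lower semicontinuous under `L¹` convergence, as a supremum of continuous
functionals. -/
theorem variation_le_of_tendsto {φ : Seminorm ℝ (Rn n)} {Ω : Set (Rn n)} {u : ℕ → Rn n → ℝ}
    {g : Rn n → ℝ} (hui : ∀ k, Integrable (u k)) (hg : Integrable g)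
    (hL : Tendsto (fun k => ∫⁻ x, ‖u k x - g x‖ₑ) atTop (𝓝 0)) {a : ENNReal}
    (ha : Tendsto (fun k => variation φ Ω (u k)) atTop (𝓝 a)) : variation φ Ω g ≤ a := by
  refine iSup₂_le fun η hη => ?_
  obtain ⟨C, hC⟩ :=
    (divergence_hasCompactSupport hη.2.1).exists_bound_of_continuous (divergence_continuous hη.1)
  refine le_of_tendsto_of_tendsto' (ENNReal.tendsto_ofReal
    (tendsto_integral_mul_of_tendsto_lintegral hui hg hL Ω (divergence_continuous hη.1) hC)) ha
    fun k => ?_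
  exact le_iSup₂ (f := fun η (_ : η ∈ testFields φ) =>
    ENNReal.ofReal (∫ x in Ω, u k x * divergence η x)) η hη

theorem exists_pos_forall_le_mul_norm (φ : Seminorm ℝ (Rn n)) :
    ∃ C : ℝ, 0 < C ∧ ∀ x, φ x ≤ C * ‖x‖ := by
  have hs : 0 ≤ ∑ i, φ (EuclideanSpace.single i (1 : ℝ)) :=
    Finset.sum_nonneg fun i _ => apply_nonneg _ _
  refine ⟨∑ i, φ (EuclideanSpace.single i (1 : ℝ)) + 1, by positivity, fun x => ?_⟩
  have hx : x = ∑ i, x i • EuclideanSpace.single i (1 : ℝ) := by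
    simpa using ((EuclideanSpace.basisFun (Fin n) ℝ).sum_repr x).symm
  calc φ x = φ (∑ i, x i • EuclideanSpace.single i (1 : ℝ)) := by rw [← hx]
    _ ≤ ∑ i, φ (x i • EuclideanSpace.single i (1 : ℝ)) :=
        Finset.le_sum_of_subadditive φ (map_zero φ).le (map_add_le_add φ) _ _
    _ ≤ ∑ i, φ (EuclideanSpace.single i (1 : ℝ)) * ‖x‖ := by
        refine Finset.sum_le_sum fun i _ => ?_
        rw [map_smul_eq_mul, mul_comm]
        gcongr
        exact PiLp.norm_apply_le x i
    _ ≤ _ := by rw [← Finset.sum_mul]; nlinarith [norm_nonneg x]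

theorem variation_norm_univ_le {φ : Seminorm ℝ (Rn n)} {C : ℝ} (hC0 : 0 < C)
    (hC : ∀ x, φ x ≤ C * ‖x‖) {Ω : Set (Rn n)} (hΩ : MeasurableSet Ω) {u : Rn n → ℝ}
    (hu0 : ∀ᵐ x, x ∉ Ω → u x = 0) :
    variation (normSeminorm ℝ (Rn n)) Set.univ u ≤ ENNReal.ofReal C * variation φ Ω u := by
  refine iSup₂_le fun η hη => ?_
  have hη' : (fun x => C⁻¹ • η x) ∈ testFields φ := by
    refine ⟨contDiff_const.fun_smul hη.1,
      hη.2.1.comp_left (g := fun y => C⁻¹ • y) (smul_zero _), fun x => ?_⟩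
    have h1 : ‖η x‖ ≤ 1 := hη.2.2 x
    rw [map_smul_eq_mul, Real.norm_of_nonneg (by positivity), inv_mul_le_iff₀ hC0]
    exact (hC _).trans (by gcongr)
  have hdiv : ∀ x, divergence (fun x => C⁻¹ • η x) x = C⁻¹ * divergence η x := by
    intro x
    have hd := ((hη.1.differentiable one_ne_zero x).hasFDerivAt.const_smul C⁻¹).fderiv
    simp only [divergence, Finset.mul_sum]
    refine Finset.sum_congr rfl fun i _ => ?_
    rw [show fderiv ℝ (fun x => C⁻¹ • η x) x = C⁻¹ • fderiv ℝ η x from hd]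
    simp
  have hint : ∫ x in Set.univ, u x * divergence η x
      = C * ∫ x in Ω, u x * divergence (fun x => C⁻¹ • η x) x := by
    rw [Measure.restrict_univ, ← integral_const_mul,
      ← integral_indicator hΩ]
    refine integral_congr_ae ?_
    filter_upwards [hu0] with x hx
    by_cases hxΩ : x ∈ Ω
    · simp only [Set.indicator_of_mem hxΩ, hdiv]
      field_simp
    · simp [hxΩ, hx hxΩ]
  rw [hint, ENNReal.ofReal_mul hC0.le]
  gcongr
  exact le_iSup₂ (f := fun η (_ : η ∈ testFields φ) =>
    ENNReal.ofReal (∫ x in Ω, u x * divergence η x)) _ hη'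

/-! ### Boxes and existence of competitors -/

/-- The box `∏ᵢ [aᵢ, bᵢ]` as a subset of Euclidean space. -/
def euclideanBox (a b : Fin n → ℝ) : Set (Rn n) := WithLp.ofLp ⁻¹' Set.Icc a b

theorem isClosed_euclideanBox (a b : Fin n → ℝ) : IsClosed (euclideanBox a b) :=
  isClosed_Icc.preimage (PiLp.continuous_ofLp 2 _)

theorem volume_euclideanBox (a b : Fin n → ℝ) :
    volume (euclideanBox a b) = ∏ i, ENNReal.ofReal (b i - a i) := by
  rw [euclideanBox, (PiLp.volume_preserving_ofLp (Fin n)).measure_preimage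
    measurableSet_Icc.nullMeasurableSet, Real.volume_Icc_pi]

/-- By the divergence theorem the flux of a field of norm at most `1` out of a box is at most the
total area of its faces. -/
theorem setIntegral_divergence_euclideanBox_le {k : ℕ} {a b : Fin (k + 1) → ℝ} (hab : a ≤ b)
    {η : Rn (k + 1) → Rn (k + 1)} (hη : ContDiff ℝ 1 η) (h1 : ∀ x, ‖η x‖ ≤ 1) :
    ∫ x in euclideanBox a b, divergence η x ≤
      ∑ i : Fin (k + 1), 2 * volume.real (Set.Icc (a ∘ i.succAbove) (b ∘ i.succAbove)) := by
  let L : (Fin (k + 1) → ℝ) →L[ℝ] Rn (k + 1) :=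
    (PiLp.continuousLinearEquiv 2 ℝ fun _ : Fin (k + 1) => ℝ).symm.toContinuousLinearMap
  have hpre : ∫ x in euclideanBox a b, divergence η x
      = ∫ y in Set.Icc a b, divergence η (WithLp.toLp 2 y) := by
    have := (PiLp.volume_preserving_ofLp (Fin (k + 1))).setIntegral_preimage_emb
      (MeasurableEquiv.toLp 2 (Fin (k + 1) → ℝ)).symm.measurableEmbedding
      (fun y => divergence η (WithLp.toLp 2 y)) (Set.Icc a b)
    simpa [euclideanBox] using this
  let f : Fin (k + 1) → (Fin (k + 1) → ℝ) → ℝ := fun i y => η (L y) i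
  let f' : Fin (k + 1) → (Fin (k + 1) → ℝ) → (Fin (k + 1) → ℝ) →L[ℝ] ℝ := fun i y =>
    (EuclideanSpace.proj i).comp ((fderiv ℝ η (L y)).comp L)
  have hder : ∀ i y, HasFDerivAt (f i) (f' i y) y := fun i y =>
    (EuclideanSpace.proj (𝕜 := ℝ) i).hasFDerivAt.comp y
      (((hη.differentiable one_ne_zero (L y)).hasFDerivAt).comp y L.hasFDerivAt)
  have hdiv : ∀ y, divergence η (WithLp.toLp 2 y) = ∑ i, f' i y (Pi.single i 1) := fun y => rfl
  have hcont : Continuous fun y => ∑ i, f' i y (Pi.single i 1) := by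
    simp only [← hdiv]
    exact (divergence_continuous hη).comp (PiLp.continuous_toLp 2 _)
  have hface : ∀ i (g : (Fin k → ℝ) → (Fin (k + 1) → ℝ)),
      |∫ y in Set.Icc (a ∘ i.succAbove) (b ∘ i.succAbove), f i (g y)|
        ≤ volume.real (Set.Icc (a ∘ i.succAbove) (b ∘ i.succAbove)) := by
    intro i g
    have := norm_setIntegral_le_of_norm_le_const (μ := volume)
      (s := Set.Icc (a ∘ i.succAbove) (b ∘ i.succAbove)) (f := fun y => f i (g y)) (C := 1)
      isCompact_Icc.measure_lt_top (fun y _ => (PiLp.norm_apply_le _ i).trans (h1 _))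
    simpa using this
  rw [hpre]
  simp only [hdiv]
  rw [integral_divergence_of_hasFDerivAt_off_countable' a b hab f f' ∅ Set.countable_empty
    (fun i => (continuous_iff_continuousAt.2 fun y => (hder i y).continuousAt).continuousOn)
    (fun y _ i => hder i y) (hcont.continuousOn.integrableOn_compact isCompact_Icc)]
  refine Finset.sum_le_sum fun i _ => ?_
  have h2 := abs_le.1 (hface i (Fin.insertNth (α := fun _ => ℝ) i (b i)))
  have h3 := abs_le.1 (hface i (Fin.insertNth (α := fun _ => ℝ) i (a i)))
  linarith [h2.2, h3.1]

theorem memBV_indicator_euclideanBox {k : ℕ} {a b : Fin (k + 1) → ℝ} (hab : a ≤ b) {c : ℝ}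
    (hc : 0 ≤ c) : MemBV ((euclideanBox a b).indicator fun _ => c) := by
  have hm := (isClosed_euclideanBox a b).measurableSet
  have hv : volume (euclideanBox a b) ≠ ⊤ := by
    rw [volume_euclideanBox]
    exact ENNReal.prod_ne_top fun i _ => ENNReal.ofReal_ne_top
  refine ⟨(integrable_indicator_iff hm).2 (integrableOn_const hv),
    lt_of_le_of_lt (iSup₂_le fun η hη => ENNReal.ofReal_le_ofReal ?_)
      (ENNReal.ofReal_lt_top (r := c * ∑ i : Fin (k + 1),
        2 * volume.real (Set.Icc (a ∘ i.succAbove) (b ∘ i.succAbove))))⟩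
  have : ∀ x, (euclideanBox a b).indicator (fun _ => c) x * divergence η x
      = (euclideanBox a b).indicator (fun x => c * divergence η x) x := fun x => by
    by_cases hx : x ∈ euclideanBox a b <;> simp [hx]
  simp only [this, Measure.restrict_univ]
  rw [integral_indicator hm, integral_const_mul]
  exact mul_le_mul_of_nonneg_left (setIntegral_divergence_euclideanBox_le hab hη.1 hη.2.2) hc

/-- An integer multiple of the indicator of a small cube contained in `Ω` is a competitor. -/
theorem competitors_nonempty (hn : 1 ≤ n) {Ω : Set (Rn n)} (hΩ : IsOpen Ω) (hne : Ω.Nonempty)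
    {m : ℝ} (hm : 0 ≤ m) : (competitors Ω m).Nonempty := by
  obtain ⟨k, rfl⟩ : ∃ k, n = k + 1 := ⟨n - 1, by omega⟩
  obtain ⟨x₀, hx₀⟩ := hne
  have hΩ' : IsOpen (WithLp.toLp 2 ⁻¹' Ω : Set (Fin (k + 1) → ℝ)) :=
    hΩ.preimage (PiLp.continuous_toLp 2 _)
  obtain ⟨r, hr, hball⟩ := Metric.nhds_basis_closedBall.mem_iff.1
    (hΩ'.mem_nhds (x := x₀.ofLp) hx₀)
  obtain ⟨N, hN⟩ := exists_nat_gt (m / r ^ (k + 1))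
  have hN0 : (0 : ℝ) < N := lt_of_le_of_lt (by positivity) hN
  -- The side length `s` is chosen so that `N s ^ (k + 1) = m`.
  set s : ℝ := (m / N) ^ (((k + 1 : ℕ) : ℝ)⁻¹)
  have hs0 : 0 ≤ s := by positivity
  have hspow : s ^ (k + 1) = m / N := Real.rpow_inv_natCast_pow (by positivity) (Nat.succ_ne_zero k)
  have hsr : s ≤ r := by
    refine le_of_pow_le_pow_left₀ (Nat.succ_ne_zero k) hr.le ?_
    rw [Nat.succ_eq_add_one, hspow, div_le_iff₀ hN0]
    rw [div_lt_iff₀ (by positivity)] at hN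
    linarith
  set a : Fin (k + 1) → ℝ := x₀.ofLp
  set b : Fin (k + 1) → ℝ := fun i => a i + s
  have hab : a ≤ b := fun i => by simp [b, hs0]
  have hsub : euclideanBox a b ⊆ Ω := by
    intro x hx
    refine hball (a := x.ofLp) ?_
    rw [Metric.mem_closedBall, dist_pi_le_iff hr.le]
    intro i
    have h1 := hx.1 i
    have h2 := hx.2 i
    rw [Real.dist_eq, abs_of_nonneg (sub_nonneg.2 h1)]
    simp only [b] at h2
    linarith
  have hmb := (isClosed_euclideanBox a b).measurableSet
  have hvol : volume.real (euclideanBox a b) = s ^ (k + 1) := by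
    rw [measureReal_def, volume_euclideanBox]
    simp [b, ENNReal.toReal_ofReal hs0]
  refine ⟨(euclideanBox a b).indicator fun _ => (N : ℝ), memBV_indicator_euclideanBox hab hN0.le,
    ae_of_all _ fun x hx => Set.indicator_of_notMem (fun h => hx (hsub h)) _,
    ae_of_all _ fun x => ?_, ?_⟩
  · by_cases hx : x ∈ euclideanBox a b
    · exact ⟨N, by simp [hx]⟩
    · exact ⟨0, by simp [hx]⟩
  · rw [setIntegral_indicator hmb, Set.inter_eq_self_of_subset_right hsub, setIntegral_const, hvol,
      hspow, smul_eq_mul, div_mul_cancel₀ _ hN0.ne']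

/-! ### Closedness of the constraints and existence of a minimizer -/

theorem integral_abs_of_mem_competitors {Ω : Set (Rn n)} (hΩ : MeasurableSet Ω) {m : ℝ}
    {u : Rn n → ℝ} (hu : u ∈ competitors Ω m) : ∫ x, |u x| = m := by
  rw [← hu.2.2.2, ← integral_indicator hΩ]
  refine integral_congr_ae ?_
  filter_upwards [hu.2.1, hu.2.2.1] with x h0 ⟨k, hk⟩
  by_cases hx : x ∈ Ω
  · simp [hx, hk]
  · simp [hx, h0 hx]

/-- The constraints pass to the limit under convergence in `L¹` and almost everywhere. -/
theorem mem_competitors_of_tendsto {Ω : Set (Rn n)} {m : ℝ} {u : ℕ → Rn n → ℝ} {g : Rn n → ℝ}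
    (hu : ∀ k, u k ∈ competitors Ω m) (hg : MemBV g)
    (hae : ∀ᵐ x, Tendsto (fun k => u k x) atTop (𝓝 (g x)))
    (hL : Tendsto (fun k => ∫⁻ x, ‖u k x - g x‖ₑ) atTop (𝓝 0)) : g ∈ competitors Ω m := by
  refine ⟨hg, ?_, ?_, ?_⟩
  · filter_upwards [hae, ae_all_iff.2 fun k => (hu k).2.1] with x hx h0 hxΩ
    exact tendsto_nhds_unique hx (by simp [h0 _ hxΩ])
  · filter_upwards [hae, ae_all_iff.2 fun k => (hu k).2.2.1] with x hx hk
    have hcl : IsClosed (Set.range ((↑) : ℕ → ℝ)) := Nat.isClosedEmbedding_coe_real.isClosed_range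
    obtain ⟨k, hk⟩ := hcl.mem_of_tendsto hx
      (Eventually.of_forall fun k => by obtain ⟨j, hj⟩ := hk k; exact ⟨j, hj.symm⟩)
    exact ⟨k, hk.symm⟩
  · have h1 := tendsto_integral_mul_of_tendsto_lintegral (fun k => (hu k).1.1) hg.1 hL Ω
      (f := fun _ => 1) continuous_const (C := 1) (by simp)
    simp only [mul_one, (hu _).2.2.2] at h1
    exact tendsto_nhds_unique h1 tendsto_const_nhds

end AnisoVar

theorem mainTheorem10 (n : ℕ) (hn : 1 ≤ n)
    (φ : Seminorm ℝ (AnisoVar.Rn n)) (hφ : ∀ x, φ x = 0 → x = 0)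
    (Ω : Set (AnisoVar.Rn n)) (hΩ : IsOpen Ω) (hne : Ω.Nonempty) (hfin : volume Ω < ⊤)
    (m : ℝ) (hm : 0 ≤ m) :
    ∃ u : AnisoVar.Rn n → ℝ, AnisoVar.IsMinimizer φ Ω m u := by
  open AnisoVar Filter Topology in
  have hcomp := competitors_nonempty hn hΩ hne hm
  obtain ⟨I, hI⟩ : ∃ I, I = sInf (variation φ Ω '' competitors Ω m) := ⟨_, rfl⟩
  have hle : ∀ v ∈ competitors Ω m, I ≤ variation φ Ω v := fun v hv =>
    hI ▸ sInf_le (Set.mem_image_of_mem _ hv)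
  -- If the infimum were `⊤`, every competitor would be a minimizer.
  rcases eq_or_ne I ⊤ with htop | htop
  · obtain ⟨u, hu⟩ := hcomp
    exact ⟨u, hu, fun v hv => le_top.trans (htop ▸ hle v hv)⟩
  obtain ⟨t, -, ht, hmem⟩ := exists_seq_tendsto_sInf (hcomp.image (variation φ Ω))
    (OrderBot.bddBelow _)
  rw [← hI] at ht
  choose w hw hwt using hmem
  -- Discarding finitely many terms, the variations along the minimizing sequence are bounded.
  have hlt : I < I + 1 := ENNReal.lt_add_right htop one_ne_zero
  obtain ⟨N, hN⟩ := eventually_atTop.1 (ht.eventually_lt_const hlt)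
  obtain ⟨C, hC0, hC⟩ := exists_pos_forall_le_mul_norm φ
  have hIt : I + 1 ≠ ⊤ := ENNReal.add_ne_top.2 ⟨htop, ENNReal.one_ne_top⟩
  have hV : ∀ k, variation (normSeminorm ℝ (Rn n)) Set.univ (w (k + N)) ≤
      ENNReal.ofReal (C * (I + 1).toReal) := by
    intro k
    refine (variation_norm_univ_le hC0 hC hΩ.measurableSet (hw _).2.1).trans ?_
    rw [ENNReal.ofReal_mul hC0.le, ENNReal.ofReal_toReal hIt, hwt]
    gcongr
    exact (hN _ (Nat.le_add_left _ _)).le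
  obtain ⟨σ, hσ, g, hg, hae, hL⟩ := exists_subseq_tendsto_of_variation_le hΩ.measurableSet hfin
    (u := fun k => w (k + N)) (fun k => (hw _).1.1) (fun k => (hw _).2.1)
    (fun k => (integral_abs_of_mem_competitors hΩ.measurableSet (hw _)).le) (by positivity) hV
  have hgvar : variation φ Ω g ≤ I := by
    refine variation_le_of_tendsto (fun k => (hw (σ k + N)).1.1) hg hL ?_
    simp only [hwt]
    exact ht.comp ((tendsto_add_atTop_nat N).comp hσ.tendsto_atTop)
  have hg0 : ∀ᵐ x, x ∉ Ω → g x = 0 := by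
    filter_upwards [hae, ae_all_iff.2 fun k => (hw k).2.1] with x hx h0 hxΩ
    exact tendsto_nhds_unique hx (by simp [h0 _ hxΩ])
  have hgBV : MemBV g := ⟨hg, (variation_norm_univ_le hC0 hC hΩ.measurableSet hg0).trans_lt
    (ENNReal.mul_lt_top ENNReal.ofReal_lt_top (hgvar.trans_lt htop.lt_top))⟩
  exact ⟨g, mem_competitors_of_tendsto (fun k => hw (σ k + N)) hgBV hae hL,
    fun v hv => hgvar.trans (hle v hv)⟩
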